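/- Let $d\ge 1$, $\mathbb{D}=\{z\in\mathbb{C}:|z|<1\}$, and let $A_{\mathrm{sym}}(\mathbb{D}^d)$ be the complex commutative unital Banach algebra (pointwise operations, supremum norm) of all continuous functions $f:\overline{\mathbb{D}}^d\to\mathbb{C}$ that are holomorphic in $\mathbb{D}^d$ and symmetric, i.e. $f(z_1,\dots,z_d)=f(z_{\sigma(1)},\dots,z_{\sigma(d)})$ for all $\mathbf z=(z_1,\dots,z_d)\in\mathbb{D}^d$ and all permutations $\sigma\in S_d$. Let $M$ be its maximal ideal space, i.e. the set of all nonzero multiplicative linear functionals $\varphi:A_{\mathrm{sym}}(\mathbb{D}^d)\to\mathbb{C}$. Let $\overline{\mathbb{D}}^d/\!\sim$ be the space of orbits $[\mathbf z]$ of $\overline{\mathbb{D}}^d$ under the action of $S_d$ by permutation of coordinates, with the quotient topology. Then every $\varphi\in M$ is continuous, and, when $M$ carries the Gelfand topology (induced by the weak-$*$ topology of the dual space), the map $$\iota:\ \overline{\mathbb{D}}^d/\!\sim\ \longrightarrow\ M,\qquad \iota([\mathbf z])(f)=f(\mathbf z)\quad (f\in A_{\mathrm{sym}}(\mathbb{D}^d)),$$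 is a well-defined homeomorphism. In particular, $M$ is homeomorphic to $\overline{\mathbb{D}}^d/\!\sim$. -/

import Mathlib

namespace SymPolydisc

/-- The open polydisc `𝔻^d`. -/
def openPolydisc (d : ℕ) : Set (Fin d → ℂ) := {z | ∀ i, ‖z i‖ < 1}

/-- The closed polydisc, with the subspace topology from `ℂ^d`. -/
abbrev ClosedPolydisc (d : ℕ) : Type := {z : Fin d → ℂ // ∀ i, ‖z i‖ ≤ 1}

instance (d : ℕ) : CompactSpace (ClosedPolydisc d) := by
  refine (isCompact_iff_compactSpace (s := {z : Fin d → ℂ | ∀ i, ‖z i‖ ≤ 1})).mp ?_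
  have h : IsCompact (Set.univ.pi fun _ : Fin d => Metric.closedBall (0 : ℂ) 1) :=
    isCompact_univ_pi fun _ => isCompact_closedBall 0 1
  convert h using 1
  ext z
  simp [Set.mem_pi]

/-- `σ z = (z_{σ(1)}, …, z_{σ(d)})`. -/
def permute {d : ℕ} (σ : Equiv.Perm (Fin d)) (z : ClosedPolydisc d) : ClosedPolydisc d :=
  ⟨fun i => z.1 (σ i), fun i => z.2 (σ i)⟩

/-- The polydisc algebra: continuous functions on the closed polydisc that are holomorphic
in the open polydisc. The norm inherited from `C(ClosedPolydisc d, ℂ)` is the supremum over the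
closed polydisc, which by continuity is the supremum over the open one. -/
def polydiscAlgebra (d : ℕ) : Subalgebra ℂ C(ClosedPolydisc d, ℂ) where
  carrier := {f | ∃ F : (Fin d → ℂ) → ℂ, DifferentiableOn ℂ F (openPolydisc d) ∧
    ∀ z : ClosedPolydisc d, z.1 ∈ openPolydisc d → F z.1 = f z}
  mul_mem' := by
    rintro f g ⟨F, hF, hFf⟩ ⟨G, hG, hGg⟩
    exact ⟨fun z => F z * G z, hF.mul hG, fun z hz => by simp [hFf z hz, hGg z hz]⟩
  add_mem' := by
    rintro f g ⟨F, hF, hFf⟩ ⟨G, hG, hGg⟩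
    exact ⟨fun z => F z + G z, hF.add hG, fun z hz => by simp [hFf z hz, hGg z hz]⟩
  algebraMap_mem' c := ⟨fun _ => c, differentiableOn_const c, fun z _ => by simp⟩

/-- The symmetric functions in the polydisc algebra. -/
def symPolydiscAlgebra (d : ℕ) : Subalgebra ℂ C(ClosedPolydisc d, ℂ) where
  carrier := {f | f ∈ polydiscAlgebra d ∧
    ∀ z : ClosedPolydisc d, z.1 ∈ openPolydisc d →
      ∀ σ : Equiv.Perm (Fin d), f z = f (permute σ z)}
  mul_mem' := by
    rintro f g ⟨hf, hf'⟩ ⟨hg, hg'⟩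
    exact ⟨mul_mem hf hg, fun z hz σ => by
      rw [ContinuousMap.mul_apply, ContinuousMap.mul_apply, hf' z hz σ, hg' z hz σ]⟩
  add_mem' := by
    rintro f g ⟨hf, hf'⟩ ⟨hg, hg'⟩
    exact ⟨add_mem hf hg, fun z hz σ => by
      rw [ContinuousMap.add_apply, ContinuousMap.add_apply, hf' z hz σ, hg' z hz σ]⟩
  algebraMap_mem' c := ⟨algebraMap_mem _ c, fun z _ σ => by simp⟩

/-- `z ∼ w` if `w = σ z` for some permutation `σ` of the coordinates. -/
def orbitSetoid (d : ℕ) : Setoid (ClosedPolydisc d) where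
  r z w := ∃ σ : Equiv.Perm (Fin d), w = permute σ z
  iseqv :=
    { refl := fun z => ⟨1, rfl⟩
      symm := by
        rintro z w ⟨σ, rfl⟩
        exact ⟨σ⁻¹, Subtype.ext (funext fun i => by simp [permute])⟩
      trans := by
        rintro z w u ⟨σ, rfl⟩ ⟨τ, rfl⟩
        exact ⟨σ * τ, rfl⟩ }

/-- The orbit space, with the quotient topology. -/
abbrev OrbitSpace (d : ℕ) : Type := Quotient (orbitSetoid d)

end SymPolydisc

/-! A character `φ` is pinned down by its values on the elementary symmetric polynomials `e_j`. The
monic polynomial with coefficients `φ(e_j)` factors as `∏ (X + z_i)`, so `φ(e_j) = e_j(z)`. A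
function of the algebra without zeros on the closed polydisc is invertible, because `1/f` stays in
the algebra; this forces `|z_i| ≤ 1` and also `|φ(f)| ≤ ‖f‖`. Since the `e_j` generate the symmetric
polynomials, `φ` is evaluation at `z` once these are dense.

Density: `f` is uniformly close to a dilate `f(r·)`, which a Banach-algebra-valued Cauchy integral
places in the closure of the polynomials; averaging over permutations makes the approximants
symmetric.

The `e_j(z)` determine the orbit of `z`, so evaluation is a continuous bijection from a compact
space to a Hausdorff one. -/

namespace SymPolydisc

open Complex MeasureTheory Set
open scoped Real

/-- The coordinate functions on the closed polydisc. -/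
def coord {d : ℕ} (i : Fin d) : C(ClosedPolydisc d, ℂ) :=
  ⟨fun z => z.1 i, (continuous_apply i).comp continuous_subtype_val⟩

@[simp]
theorem coord_apply {d : ℕ} (i : Fin d) (z : ClosedPolydisc d) : coord i z = z.1 i := rfl

/-- Restriction of polynomials to the closed polydisc. -/
noncomputable def polyMap (d : ℕ) : MvPolynomial (Fin d) ℂ →ₐ[ℂ] C(ClosedPolydisc d, ℂ) :=
  MvPolynomial.aeval coord

theorem polyMap_apply {d : ℕ} (p : MvPolynomial (Fin d) ℂ) (z : ClosedPolydisc d) :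
    polyMap d p z = MvPolynomial.eval z.1 p := by
  have h : (ContinuousMap.evalAlgHom ℂ ℂ z).comp (polyMap d) = MvPolynomial.aeval z.1 :=
    MvPolynomial.algHom_ext fun i => by simp [polyMap]
  exact DFunLike.congr_fun h p

/-! ### Cauchy's integral formula on polydiscs -/

theorem continuous_torusMap {d : ℕ} (c : Fin d → ℂ) (R : Fin d → ℝ) :
    Continuous (torusMap c R) := by
  unfold torusMap; fun_prop

theorem norm_torusMap_zero_apply {d : ℕ} {R : ℝ} (hR : 0 ≤ R) (θ : Fin d → ℝ) (i : Fin d) :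
    ‖torusMap 0 (fun _ => R) θ i‖ = R := by
  simp [torusMap, norm_exp_ofReal_mul_I, abs_of_nonneg hR]

theorem torusIntegrable_of_continuous {d : ℕ} {E : Type*} [NormedAddCommGroup E]
    {f : (Fin d → ℂ) → E} {c : Fin d → ℂ} {R : Fin d → ℝ}
    (hf : Continuous fun θ => f (torusMap c R θ)) : TorusIntegrable f c R :=
  hf.continuousOn.integrableOn_compact isCompact_Icc

theorem continuous_cauchyKernel_mul {d : ℕ} {F : (Fin d → ℂ) → ℂ}
    (hF : ContinuousOn F (openPolydisc d)) {R : ℝ} (hR : 0 ≤ R) (hR1 : R < 1)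
    {z : Fin d → ℂ} (hz : ∀ i, ‖z i‖ < R) :
    Continuous fun θ : Fin d → ℝ => (∏ i, (torusMap 0 (fun _ => R) θ i - z i)⁻¹) *
      F (torusMap 0 (fun _ => R) θ) := by
  have ht := continuous_torusMap (d := d) 0 (fun _ => R)
  refine Continuous.mul (continuous_finsetProd _ fun i _ => Continuous.inv₀ ?_ fun θ h => ?_)
    (hF.comp_continuous ht fun θ i => ?_)
  · exact ((continuous_apply i).comp ht).sub continuous_const
  · have := norm_torusMap_zero_apply hR θ i
    rw [sub_eq_zero.1 h] at this
    exact (hz i).ne this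
  · rw [norm_torusMap_zero_apply hR]; exact hR1

/-- Cauchy's integral formula on a polydisc. -/
theorem torusIntegral_cauchy {d : ℕ} {F : (Fin d → ℂ) → ℂ}
    (hF : DifferentiableOn ℂ F (openPolydisc d)) {R : ℝ} (hR : 0 < R) (hR1 : R < 1)
    {z : Fin d → ℂ} (hz : ∀ i, ‖z i‖ < R) :
    (∯ w in T(0, fun _ => R), (∏ i, (w i - z i)⁻¹) * F w) = (2 * π * I) ^ d * F z := by
  induction d with
  | zero =>
    rw [torusIntegral_dim0]
    simp [Subsingleton.elim z 0]
  | succ d ih =>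
    rw [torusIntegral_succ (torusIntegrable_of_continuous
      (continuous_cauchyKernel_mul hF.continuousOn hR.le hR1 hz))]
    have hcons : ∀ x : ℂ, ‖x‖ < 1 →
        DifferentiableOn ℂ (fun y : Fin d → ℂ => F (Fin.cons x y)) (openPolydisc d) := by
      intro x hx
      refine hF.comp (t := openPolydisc (d + 1)) ?_ ?_
      · refine Differentiable.differentiableOn (differentiable_pi.2 fun i => ?_)
        refine Fin.cases ?_ (fun j => ?_) i <;> simp
        fun_prop
      · intro y hy i
        refine Fin.cases ?_ (fun j => ?_) i
        · simpa using hx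
        · simpa using hy j
    -- With the first variable fixed on its circle, the inner integral is the induction hypothesis;
    -- a one-variable Cauchy integral remains.
    have hinner : ∀ x ∈ Metric.sphere (0 : ℂ) R,
        (∯ y in T((0 : Fin (d + 1) → ℂ) ∘ Fin.succ, (fun _ : Fin (d + 1) => R) ∘ Fin.succ),
          (∏ i, ((Fin.cons x y : Fin (d + 1) → ℂ) i - z i)⁻¹) * F (Fin.cons x y)) =
        (x - z 0)⁻¹ • ((2 * π * I) ^ d * F (Fin.cons x (Fin.tail z))) := by
      intro x hx
      have hx' : ‖x‖ = R := by simpa using hx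
      rw [smul_eq_mul, ← ih (hcons x (hx' ▸ hR1)) (z := Fin.tail z) (fun i => hz i.succ),
        ← torusIntegral_const_mul]
      simp only [Fin.prod_univ_succ, Fin.cons_zero, Fin.cons_succ, mul_assoc]
      rfl
    have hc : DifferentiableOn ℂ
        (fun x : ℂ => (2 * π * I) ^ d * F (Fin.cons x (Fin.tail z))) (Metric.closedBall 0 R) := by
      refine DifferentiableOn.const_mul (hF.comp (t := openPolydisc (d + 1)) ?_ ?_) _
      · refine Differentiable.differentiableOn (differentiable_pi.2 fun i => ?_)
        refine Fin.cases ?_ (fun j => ?_) i <;> simp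
      · intro x hx i
        refine Fin.cases ?_ (fun j => ?_) i
        · simpa using (mem_closedBall_zero_iff.1 hx).trans_lt hR1
        · simpa [Fin.tail] using (hz j.succ).trans hR1
    have := hc.circleIntegral_sub_inv_smul (w := z 0) (by simpa using hz 0)
    rw [show ((0 : Fin (d + 1) → ℂ) 0) = 0 from rfl, circleIntegral.integral_congr hR.le hinner,
      this, Fin.cons_self_tail, smul_eq_mul]
    ring

/-! ### Functional calculus and dilates -/

theorem norm_coord_le {d : ℕ} (i : Fin d) : ‖coord i‖ ≤ 1 :=
  (ContinuousMap.norm_le _ zero_le_one).2 fun z => z.2 i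

/-- Holomorphic functional calculus for commuting elements of small spectrum. -/
theorem exists_forall_continuousAlgHom_eq {B : Type*} [NormedCommRing B] [NormedAlgebra ℂ B]
    [CompleteSpace B] {d : ℕ} {F : (Fin d → ℂ) → ℂ}
    (hF : DifferentiableOn ℂ F (openPolydisc d)) {R : ℝ} (hR : 0 < R) (hR1 : R < 1)
    {b : Fin d → B} (hb : ∀ i, ∀ w : ℂ, ‖w‖ = R → IsUnit (algebraMap ℂ B w - b i)) :
    ∃ g : B, ∀ χ : B →A[ℂ] ℂ, (∀ i, ‖χ (b i)‖ < R) → χ g = F fun i => χ (b i) := by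
  let t : (Fin d → ℝ) → Fin d → ℂ := torusMap 0 fun _ => R
  have ht : Continuous t := continuous_torusMap 0 fun _ => R
  have htR : ∀ θ i, ‖t θ i‖ = R := norm_torusMap_zero_apply hR.le
  -- On the torus `hb` makes each factor a unit, so the default value of `Ring.inverse` plays no
  -- role.
  let G : (Fin d → ℂ) → B := fun w => F w • ∏ i, Ring.inverse (algebraMap ℂ B (w i) - b i)
  have hGc : Continuous fun θ => G (t θ) := by
    refine Continuous.smul (hF.continuousOn.comp_continuous ht fun θ i => ?_)
      (continuous_finsetProd _ fun i _ => continuous_iff_continuousAt.2 fun θ => ?_)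
    · rw [htR]; exact hR1
    · obtain ⟨u, hu⟩ := hb i (t θ i) (htR θ i)
      have h1 : ContinuousAt (Ring.inverse : B → B) (algebraMap ℂ B (t θ i) - b i) :=
        hu ▸ NormedRing.inverse_continuousAt u
      have h2 : Continuous fun θ => algebraMap ℂ B (t θ i) - b i :=
        ((continuous_algebraMap ℂ B).comp ((continuous_apply i).comp ht)).sub continuous_const
      exact ContinuousAt.comp (f := fun θ => algebraMap ℂ B (t θ i) - b i) h1 h2.continuousAt
  -- A continuous character passes under the integral and turns the resolvents into scalar Cauchy
  -- kernels.
  refine ⟨((2 * π * I) ^ d)⁻¹ • ∯ w in T(0, fun _ => R), G w, fun χ hχ => ?_⟩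
  have hinv : ∀ {a : B}, IsUnit a → χ (Ring.inverse a) = (χ a)⁻¹ := fun {a} ha =>
    eq_inv_of_mul_eq_one_left (by rw [← map_mul, Ring.inverse_mul_cancel a ha, map_one])
  have key : χ (∯ w in T(0, fun _ => R), G w) = (2 * π * I) ^ d * F fun i => χ (b i) := by
    rw [← torusIntegral_cauchy hF hR hR1 hχ, torusIntegral, torusIntegral]
    refine (χ.toContinuousLinearMap.integral_comp_comm
      (torusIntegrable_of_continuous hGc).function_integrable).symm.trans ?_
    refine integral_congr_ae (Filter.Eventually.of_forall fun θ => ?_)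
    change χ (_ • F (t θ) • _) = _ • (_ * F (t θ))
    rw [map_smul, map_smul, map_prod, smul_eq_mul (F (t θ)), mul_comm (F (t θ))]
    refine congrArg (fun x => _ • (x * F (t θ))) (Finset.prod_congr rfl fun i _ => ?_)
    rw [hinv (hb i _ (htR θ i)), map_sub, AlgHomClass.commutes]
    rfl
  rw [map_smul, key, smul_eq_mul, inv_mul_cancel_left₀ (pow_ne_zero _ two_pi_I_ne_zero)]

/-- Spectral values of `a` are bounded by `‖a‖ * ‖1‖`, here at most `r`. -/
theorem isUnit_algebraMap_sub_smul {B : Type*} [NormedCommRing B] [NormedAlgebra ℂ B]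
    [CompleteSpace B] (h1 : ‖(1 : B)‖ ≤ 1) {b : B} (hb : ‖b‖ ≤ 1) {r : ℝ}
    (hr : 0 ≤ r) {w : ℂ} (hw : r < ‖w‖) : IsUnit (algebraMap ℂ B w - (r : ℂ) • b) := by
  by_contra h
  have hspec := spectrum.norm_le_norm_mul_of_mem (a := (r : ℂ) • b) (k := w) h
  have hrb : ‖(r : ℂ) • b‖ ≤ r := by
    rw [norm_smul, norm_real, Real.norm_of_nonneg hr]
    exact mul_le_of_le_one_right hr hb
  have := mul_le_mul hrb h1 (norm_nonneg _) hr
  linarith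

/-- The evaluation at a point, on a subalgebra. -/
noncomputable def evalSub {d : ℕ} (S : Subalgebra ℂ C(ClosedPolydisc d, ℂ))
    (z : ClosedPolydisc d) : S →A[ℂ] ℂ where
  toAlgHom := (ContinuousMap.evalAlgHom ℂ ℂ z).comp S.val
  cont := (ContinuousEvalConst.continuous_eval_const z).comp continuous_subtype_val

theorem evalSub_apply {d : ℕ} (S : Subalgebra ℂ C(ClosedPolydisc d, ℂ)) (z : ClosedPolydisc d)
    (g : S) : evalSub S z g = g.1 z := rfl

/-- A dilate of a function holomorphic in the polydisc belongs to every closed subalgebra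
containing the coordinate functions. -/
theorem exists_mem_eq_dilate {d : ℕ} {S : Subalgebra ℂ C(ClosedPolydisc d, ℂ)}
    (hS : IsClosed (S : Set C(ClosedPolydisc d, ℂ))) (hcoord : ∀ i, coord i ∈ S)
    {F : (Fin d → ℂ) → ℂ}
    (hF : DifferentiableOn ℂ F (openPolydisc d)) {r : ℝ} (hr : 0 ≤ r) (hr1 : r < 1) :
    ∃ g ∈ S, ∀ z : ClosedPolydisc d, g z = F (fun i => r * z.1 i) := by
  have : CompleteSpace S := hS.completeSpace_coe
  -- The circle of radius `R` encloses the spectra of the `r • Z i`, and `R < 1` keeps the torus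
  -- inside the domain of `F`.
  obtain ⟨R, hrR, hR1⟩ := exists_between hr1
  have h1 : ‖(1 : S)‖ ≤ 1 := (ContinuousMap.norm_le _ zero_le_one).2 fun z => by simp
  obtain ⟨Z, hZ⟩ : ∃ Z : Fin d → S, ∀ i, (Z i).1 = coord i := ⟨fun i => ⟨_, hcoord i⟩, fun _ => rfl⟩
  have hZn : ∀ i, ‖Z i‖ ≤ 1 := fun i => by
    change ‖(Z i).1‖ ≤ 1
    rw [hZ]
    exact norm_coord_le i
  have hb : ∀ i, ∀ w : ℂ, ‖w‖ = R → IsUnit (algebraMap ℂ S w - (r : ℂ) • Z i) :=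
    fun i w hw => isUnit_algebraMap_sub_smul h1 (hZn i) hr (hw ▸ hrR)
  obtain ⟨g, hg⟩ := exists_forall_continuousAlgHom_eq hF (hr.trans_lt hrR) hR1 hb
  refine ⟨g.1, g.2, fun z => ?_⟩
  have hev : ∀ i, evalSub S z ((r : ℂ) • Z i) = r * z.1 i := fun i => by
    rw [map_smul, evalSub_apply, hZ, coord_apply, smul_eq_mul]
  have hz : ∀ i, ‖(r : ℂ) * z.1 i‖ < R := fun i => by
    rw [norm_mul, norm_real, Real.norm_of_nonneg hr]
    exact (mul_le_of_le_one_right hr (z.2 i)).trans_lt hrR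
  have := hg (evalSub S z) fun i => by rw [hev]; exact hz i
  simp only [hev] at this
  exact this

/-! ### Density of polynomials in the polydisc algebra -/

/-- The dilation of the closed polydisc by a factor `r ∈ [0, 1]`. -/
noncomputable def dilate {d : ℕ} {r : ℝ} (hr : 0 ≤ r) (hr1 : r ≤ 1) (z : ClosedPolydisc d) :
    ClosedPolydisc d :=
  ⟨fun i => r * z.1 i, fun i => by
    rw [norm_mul, norm_real, Real.norm_of_nonneg hr]
    exact mul_le_one₀ hr1 (norm_nonneg _) (z.2 i)⟩

theorem dist_dilate_le {d : ℕ} {r : ℝ} (hr : 0 ≤ r) (hr1 : r ≤ 1) (z : ClosedPolydisc d) :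
    dist z (dilate hr hr1 z) ≤ 1 - r := by
  rw [Subtype.dist_eq, dist_pi_le_iff (sub_nonneg.2 hr1)]
  intro i
  rw [dist_eq, show z.1 i - (dilate hr hr1 z).1 i = ((1 - r : ℝ) : ℂ) * z.1 i by
    simp only [dilate]; push_cast; ring, norm_mul, norm_real,
    Real.norm_of_nonneg (sub_nonneg.2 hr1)]
  exact mul_le_of_le_one_right (sub_nonneg.2 hr1) (z.2 i)

theorem dilate_mem_openPolydisc {d : ℕ} {r : ℝ} (hr : 0 ≤ r) (hr1 : r < 1)
    (z : ClosedPolydisc d) : (dilate hr hr1.le z).1 ∈ openPolydisc d := fun i => by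
  simp only [dilate, norm_mul, norm_real, Real.norm_of_nonneg hr]
  exact (mul_le_of_le_one_right hr (z.2 i)).trans_lt hr1

theorem exists_dilate_close {d : ℕ} (f : C(ClosedPolydisc d, ℂ)) {ε : ℝ} (hε : 0 < ε) :
    ∃ (r : ℝ) (hr : 0 ≤ r) (hr1 : r < 1), ∀ z, dist (f z) (f (dilate hr hr1.le z)) < ε := by
  have hu := CompactSpace.uniformContinuous_of_continuous f.continuous
  obtain ⟨δ, hδ, h⟩ := Metric.uniformContinuous_iff.1 hu ε hε
  -- Points move by at most `1 - r < δ`; the cap at `1` keeps `r ≥ 0`.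
  refine ⟨1 - min (δ / 2) 1, by simp, by simp [hδ], fun z => h ?_⟩
  refine (dist_dilate_le _ _ z).trans_lt ?_
  rw [sub_sub_cancel]
  exact (min_le_left _ _).trans_lt (half_lt_self hδ)

/-- The closure of the polynomials in the continuous functions on the closed polydisc. -/
noncomputable abbrev polyClosure (d : ℕ) : Subalgebra ℂ C(ClosedPolydisc d, ℂ) :=
  (polyMap d).range.topologicalClosure

theorem coord_mem_polyClosure {d : ℕ} (i : Fin d) : coord i ∈ polyClosure d :=
  Subalgebra.le_topologicalClosure _ ⟨MvPolynomial.X i, by simp [polyMap]⟩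

/-- The polynomials are dense in the polydisc algebra. -/
theorem polydiscAlgebra_le_polyClosure (d : ℕ) : polydiscAlgebra d ≤ polyClosure d := by
  rintro f ⟨F, hF, hFf⟩
  have hcl : IsClosed (polyClosure d : Set C(ClosedPolydisc d, ℂ)) :=
    Subalgebra.isClosed_topologicalClosure _
  rw [← SetLike.mem_coe, ← hcl.closure_eq]
  refine Metric.mem_closure_iff.2 fun ε hε => ?_
  obtain ⟨r, hr, hr1, h⟩ := exists_dilate_close f hε
  obtain ⟨g, hg, hgF⟩ := exists_mem_eq_dilate hcl coord_mem_polyClosure hF hr hr1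
  refine ⟨g, hg, (ContinuousMap.dist_lt_iff hε).2 fun z => ?_⟩
  have := hFf (dilate hr hr1.le z) (dilate_mem_openPolydisc hr hr1 z)
  rw [hgF z, show F (fun i => r * z.1 i) = f (dilate hr hr1.le z) from this]
  exact h z

end SymPolydisc

namespace SymPolydisc

open MvPolynomial

/-! ### Orbits and roots of polynomials -/

/-- Over each value the fibres of `z` and `w` have equal size; bijections between them glue to a
permutation. -/
theorem exists_perm_of_map_univ_eq {ι α : Type*} [Fintype ι] {z w : ι → α}
    (h : Multiset.map z Finset.univ.val = Multiset.map w Finset.univ.val) :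
    ∃ σ : Equiv.Perm ι, ∀ i, w i = z (σ i) := by
  classical
  have hcard : ∀ a, Nonempty ({i // w i = a} ≃ {i // z i = a}) := fun a => by
    refine ⟨Fintype.equivOfCardEq ?_⟩
    have := congrArg (Multiset.count a) h
    simp only [Multiset.count_map, ← Finset.filter_val, Finset.card_val, eq_comm (a := a)] at this
    rw [Fintype.card_subtype, Fintype.card_subtype, this]
  let σ : ι ≃ ι := (Equiv.sigmaFiberEquiv w).symm.trans
    ((Equiv.sigmaCongrRight fun a => (hcard a).some).trans (Equiv.sigmaFiberEquiv z))
  exact ⟨σ, fun i => ((hcard (w i)).some ⟨i, rfl⟩).2.symm⟩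

theorem prod_X_add_C_eq_sum_eval_esymm {d : ℕ} (x : Fin d → ℂ) :
    ∏ i, (Polynomial.X + Polynomial.C (x i)) = ∑ j ∈ Finset.range (d + 1),
      Polynomial.C (eval x (esymm (Fin d) ℂ j)) * Polynomial.X ^ (d - j) := by
  have := congrArg (Polynomial.map (eval x)) (prod_C_add_X_eq_sum_esymm ℂ (Fin d))
  simpa [Polynomial.map_prod, Polynomial.map_sum] using this

theorem coeff_sum_C_mul_X_pow {R : Type*} [Semiring R] {d : ℕ} (c : ℕ → R) {j : ℕ} (hj : j ≤ d) :
    (∑ j ∈ Finset.range (d + 1), Polynomial.C (c j) * Polynomial.X ^ (d - j)).coeff (d - j) =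
      c j := by
  simp only [Polynomial.finsetSum_coeff, Polynomial.coeff_C_mul_X_pow]
  rw [Finset.sum_eq_single_of_mem j (by simp; omega)]
  · simp
  · intro b hb hbj
    simp only [Finset.mem_range] at hb
    rw [if_neg (by omega)]

theorem exists_sum_C_mul_X_pow_eq_prod {d : ℕ} {c : ℕ → ℂ} (hc : c 0 = 1) :
    ∃ z : Fin d → ℂ, ∑ j ∈ Finset.range (d + 1), Polynomial.C (c j) * Polynomial.X ^ (d - j) =
      ∏ i, (Polynomial.X + Polynomial.C (z i)) := by
  set P := ∑ j ∈ Finset.range (d + 1), Polynomial.C (c j) * Polynomial.X ^ (d - j)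
  have hdeg : P.natDegree ≤ d := Polynomial.natDegree_sum_le_of_forall_le _ _ fun j _ =>
    (Polynomial.natDegree_C_mul_X_pow_le _ _).trans (Nat.sub_le _ _)
  have hcoeff : P.coeff d = 1 := by
    exact (coeff_sum_C_mul_X_pow c (Nat.zero_le d)).trans hc
  have hmonic : P.Monic := Polynomial.monic_of_natDegree_le_of_coeff_eq_one d hdeg hcoeff
  have hdeg' : P.natDegree = d :=
    hdeg.antisymm (Polynomial.le_natDegree_of_ne_zero (by simp [hcoeff]))
  have hsplit : P.Splits := IsAlgClosed.splits P
  have hcard : P.roots.toList.length = d := by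
    rw [Multiset.length_toList, ← hdeg', hsplit.natDegree_eq_card_roots]
  obtain ⟨r, hr⟩ : ∃ r : Fin d → ℂ, Multiset.map r Finset.univ.val = P.roots := by
    refine ⟨fun i => P.roots.toList.get (i.cast hcard.symm), ?_⟩
    rw [Fin.univ_val_map]
    conv_rhs => rw [← Multiset.coe_toList P.roots]
    congr 1
    exact List.ext_get (by simp [hcard]) fun n _ _ => by simp
  -- The factors are `X + z_i`, so the `z_i` are the negated roots.
  refine ⟨fun i => -r i, (hsplit.eq_prod_roots_of_monic hmonic).trans ?_⟩
  rw [← hr, Multiset.map_map]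
  simp [sub_eq_add_neg, Finset.prod]

/-- The `e_j(z)` are the coefficients of `∏ (X + z_i)`, whose roots with multiplicity are the
`-z_i`. -/
theorem exists_perm_of_eval_esymm_eq {d : ℕ} {z w : Fin d → ℂ}
    (h : ∀ j, eval z (esymm (Fin d) ℂ j) = eval w (esymm (Fin d) ℂ j)) :
    ∃ σ : Equiv.Perm (Fin d), ∀ i, w i = z (σ i) := by
  have hp : ∏ i, (Polynomial.X + Polynomial.C (z i)) =
      ∏ i, (Polynomial.X + Polynomial.C (w i)) := by
    simp only [prod_X_add_C_eq_sum_eval_esymm, h]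
  have hroots : ∀ x : Fin d → ℂ, (∏ i, (Polynomial.X + Polynomial.C (x i))).roots =
      Multiset.map (fun i => -x i) Finset.univ.val := fun x => by
    rw [← Polynomial.roots_multiset_prod_X_sub_C (Multiset.map (fun i => -x i) Finset.univ.val),
      Multiset.map_map]
    simp [Finset.prod]
  obtain ⟨σ, hσ⟩ := exists_perm_of_map_univ_eq ((hroots z).symm.trans (hp ▸ hroots w))
  exact ⟨σ, fun i => neg_injective (hσ i)⟩

/-! ### Density of symmetric polynomials -/

variable {d : ℕ}

theorem polyMap_mem_polydiscAlgebra (p : MvPolynomial (Fin d) ℂ) :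
    polyMap d p ∈ polydiscAlgebra d := by
  induction p using MvPolynomial.induction_on with
  | C a =>
    rw [← MvPolynomial.algebraMap_eq, AlgHom.commutes]
    exact algebraMap_mem _ a
  | add p q hp hq => rw [map_add]; exact add_mem hp hq
  | mul_X p i hp =>
    rw [map_mul]
    refine mul_mem hp ⟨fun z => z i, by fun_prop, fun z _ => ?_⟩
    rw [polyMap_apply, eval_X]

theorem eval_comp_perm {p : MvPolynomial (Fin d) ℂ} (hp : p.IsSymmetric)
    (σ : Equiv.Perm (Fin d)) (z : Fin d → ℂ) : eval (fun i => z (σ i)) p = eval z p := by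
  conv_rhs => rw [← hp σ, eval_rename]
  rfl

/-- Restriction of symmetric polynomials to the closed polydisc. -/
noncomputable def symMap (d : ℕ) :
    symmetricSubalgebra (Fin d) ℂ →ₐ[ℂ] symPolydiscAlgebra d :=
  ((polyMap d).comp (symmetricSubalgebra (Fin d) ℂ).val).codRestrict _ fun p =>
    ⟨polyMap_mem_polydiscAlgebra p.1, fun z _ σ => by
      simp only [AlgHom.comp_apply, Subalgebra.coe_val, polyMap_apply]
      exact (eval_comp_perm p.2 σ z.1).symm⟩

theorem symMap_apply (p : symmetricSubalgebra (Fin d) ℂ) (z : ClosedPolydisc d) :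
    (symMap d p).1 z = eval z.1 p.1 := polyMap_apply p.1 z

/-- Symmetry, assumed only on the open polydisc, reaches the boundary by continuity: dilations
commute with permutations and map into the open polydisc. -/
theorem apply_permute (f : symPolydiscAlgebra d) (σ : Equiv.Perm (Fin d))
    (z : ClosedPolydisc d) : f.1 (permute σ z) = f.1 z := by
  refine eq_of_forall_dist_le fun ε hε => ?_
  obtain ⟨r, hr, hr1, h⟩ := exists_dilate_close f.1 (half_pos hε)
  have h1 := h z
  have h2 := h (permute σ z)
  rw [show dilate hr hr1.le (permute σ z) = permute σ (dilate hr hr1.le z) from rfl,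
    ← f.2.2 _ (dilate_mem_openPolydisc hr hr1 z) σ] at h2
  have := dist_triangle_right (f.1 (permute σ z)) (f.1 z) (f.1 (dilate hr hr1.le z))
  linarith

/-- The average of a polynomial over all permutations of the variables. -/
noncomputable def symmetrize (p : MvPolynomial (Fin d) ℂ) : MvPolynomial (Fin d) ℂ :=
  ((d.factorial : ℂ)⁻¹) • ∑ σ : Equiv.Perm (Fin d), rename σ p

theorem symmetrize_isSymmetric (p : MvPolynomial (Fin d) ℂ) : (symmetrize p).IsSymmetric := by
  intro τ
  simp only [symmetrize, map_smul, map_sum, rename_rename]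
  congr 1
  exact Fintype.sum_equiv (Equiv.mulLeft τ) _ _ fun σ => rfl

/-- The symmetric polynomials are dense in the algebra of symmetric functions. -/
theorem exists_symMap_close (f : symPolydiscAlgebra d) {ε : ℝ} (hε : 0 < ε) :
    ∃ p : symmetricSubalgebra (Fin d) ℂ, ‖f - symMap d p‖ ≤ ε := by
  have hf : f.1 ∈ closure ((polyMap d).range : Set C(ClosedPolydisc d, ℂ)) :=
    polydiscAlgebra_le_polyClosure d f.2.1
  obtain ⟨_, ⟨p, rfl⟩, hp⟩ := Metric.mem_closure_iff.1 hf ε hε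
  refine ⟨⟨symmetrize p, symmetrize_isSymmetric p⟩,
    (ContinuousMap.norm_le _ hε.le).2 fun z => ?_⟩
  have h0 : (d.factorial : ℂ) ≠ 0 := Nat.cast_ne_zero.2 d.factorial_ne_zero
  have hterm : ∀ σ : Equiv.Perm (Fin d), ‖f.1 z - eval (fun i => z.1 (σ i)) p‖ ≤ ε := fun σ => by
    have := (ContinuousMap.dist_lt_iff hε).1 hp (permute σ z)
    rw [apply_permute, dist_eq_norm] at this
    refine le_trans (le_of_eq ?_) this.le
    congr 2
    exact (polyMap_apply p (permute σ z)).symm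
  -- By symmetry `f` is its own average, so the error of the averaged polynomial is the average of
  -- the errors.
  have key : f.1 z - eval z.1 (symmetrize p) =
      (d.factorial : ℂ)⁻¹ * ∑ σ : Equiv.Perm (Fin d), (f.1 z - eval (fun i => z.1 (σ i)) p) := by
    rw [Finset.sum_sub_distrib, Finset.sum_const, Finset.card_univ, Fintype.card_perm,
      Fintype.card_fin, nsmul_eq_mul, mul_sub, inv_mul_cancel_left₀ h0]
    simp only [symmetrize, smul_eval, map_sum, eval_rename]
    rfl
  change ‖f.1 z - (symMap d _).1 z‖ ≤ ε
  rw [symMap_apply, key, norm_mul, norm_inv, Complex.norm_natCast,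
    inv_mul_le_iff₀ (by exact_mod_cast d.factorial_pos)]
  refine (norm_sum_le _ _).trans ((Finset.sum_le_card_nsmul _ _ ε fun σ _ => hterm σ).trans ?_)
  simp [Fintype.card_perm]

/-! ### Characters are point evaluations -/

theorem isUnit_of_forall_ne_zero {f : symPolydiscAlgebra d} (hf : ∀ z, f.1 z ≠ 0) :
    IsUnit f := by
  obtain ⟨F, hF, hFf⟩ := f.2.1
  let g : C(ClosedPolydisc d, ℂ) := ⟨fun z => (f.1 z)⁻¹, f.1.continuous.inv₀ hf⟩
  have hg : g ∈ symPolydiscAlgebra d := by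
    refine ⟨⟨fun z => (F z)⁻¹, hF.inv fun z hz => ?_, fun z hz => ?_⟩, fun z _ σ => ?_⟩
    · have := hFf ⟨z, fun i => (hz i).le⟩ hz
      rw [show F z = _ from this]
      exact hf _
    · simp [g, hFf z hz]
    · simp [g, apply_permute]
  refine IsUnit.of_mul_eq_one (⟨g, hg⟩ : symPolydiscAlgebra d) (Subtype.ext ?_)
  ext z
  exact mul_inv_cancel₀ (hf z)

/-- Automatic continuity: if `|φ(f)| > ‖f‖`, then `f - φ(f)` has no zero, hence is a unit, yet `φ`
kills it. -/
theorem norm_algHom_apply_le (φ : symPolydiscAlgebra d →ₐ[ℂ] ℂ) (f : symPolydiscAlgebra d) :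
    ‖φ f‖ ≤ ‖f‖ := by
  by_contra! h
  have hu : IsUnit (f - algebraMap ℂ _ (φ f)) := isUnit_of_forall_ne_zero fun z hz => by
    have hz' : f.1 z = φ f := sub_eq_zero.1 hz
    have := f.1.norm_coe_le_norm z
    rw [hz'] at this
    exact h.not_ge this
  have := (hu.map φ).ne_zero
  simp at this

/-- A nonzero multiplicative functional is unital. -/
noncomputable def unitalOfNeZero {A : Type*} [Ring A] [Algebra ℂ A] (φ : A →ₙₐ[ℂ] ℂ)
    (hφ : φ ≠ 0) : A →ₐ[ℂ] ℂ :=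
  AlgHom.ofLinearMap (φ : A →ₗ[ℂ] ℂ) (by
    obtain ⟨f, hf⟩ : ∃ f, φ f ≠ 0 := by
      by_contra! h
      exact hφ (NonUnitalAlgHom.ext h)
    have : φ f * φ 1 = φ f * 1 := by rw [← map_mul, mul_one, mul_one]
    exact mul_left_cancel₀ hf this) (map_mul φ)

/-- Every character is the evaluation at a point of the closed polydisc. -/
theorem exists_forall_eq_apply (φ : symPolydiscAlgebra d →ₐ[ℂ] ℂ) :
    ∃ z : ClosedPolydisc d, ∀ f : symPolydiscAlgebra d, φ f = f.1 z := by
  let E : ℕ → symmetricSubalgebra (Fin d) ℂ := fun j =>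
    ⟨esymm (Fin d) ℂ j, esymm_isSymmetric _ _ _⟩
  let ψ := φ.comp (symMap d)
  have hE0 : E 0 = 1 := Subtype.ext (esymm_zero (Fin d) ℂ)
  obtain ⟨z, hz⟩ := exists_sum_C_mul_X_pow_eq_prod (d := d) (c := fun j => ψ (E j))
    (by simp [hE0])
  have hψE : ∀ j ≤ d, ψ (E j) = eval z (esymm (Fin d) ℂ j) := fun j hj => by
    have h := congrArg (Polynomial.coeff · (d - j)) hz
    rw [prod_X_add_C_eq_sum_eval_esymm] at h
    simpa only [coeff_sum_C_mul_X_pow _ hj] using h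
  -- If `|z_i| > 1`, then `u(x) = ∏ (x_k - z_i)` has no zero on the closed polydisc and is a unit,
  -- but `φ` sends it to `∏ (z_k - z_i) = 0`.
  have hnorm : ∀ i, ‖z i‖ ≤ 1 := fun i => by
    by_contra! hi
    let u := ∑ j ∈ Finset.range (d + 1), ((-z i) ^ (d - j)) • E j
    have hu : IsUnit (symMap d u) := isUnit_of_forall_ne_zero fun x => by
      have : (symMap d u).1 x = ∏ k, (-z i + x.1 k) := by
        have h := congrArg (Polynomial.eval (-z i)) (prod_X_add_C_eq_sum_eval_esymm x.1)
        simp only [Polynomial.eval_prod, Polynomial.eval_finsetSum, Polynomial.eval_add,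
          Polynomial.eval_X, Polynomial.eval_C, Polynomial.eval_mul, Polynomial.eval_pow] at h
        rw [h, symMap_apply]
        simp [u, E, mul_comm]
      rw [this]
      refine Finset.prod_ne_zero_iff.2 fun k _ h => ?_
      have hk : x.1 k = z i := by linear_combination h
      exact (hk ▸ x.2 k).not_gt hi
    refine (hu.map φ).ne_zero ?_
    have h := congrArg (Polynomial.eval (-z i)) hz
    rw [Polynomial.eval_prod, Finset.prod_eq_zero (Finset.mem_univ i) (by simp)] at h
    rw [← h]
    change ψ u = _
    rw [map_sum, Polynomial.eval_finsetSum]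
    refine Finset.sum_congr rfl fun j _ => ?_
    rw [map_smul, smul_eq_mul, mul_comm, Polynomial.eval_mul, Polynomial.eval_C,
      Polynomial.eval_pow, Polynomial.eval_X]
  have hψ : ∀ p : symmetricSubalgebra (Fin d) ℂ, ψ p = eval z p.1 := fun p => by
    obtain ⟨q, rfl⟩ := esymmAlgHom_surjective (σ := Fin d) (R := ℂ) (n := d) (by simp) p
    have : ψ.comp (esymmAlgHom (Fin d) ℂ d) =
        ((aeval z).comp (symmetricSubalgebra (Fin d) ℂ).val).comp (esymmAlgHom (Fin d) ℂ d) := by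
      refine algHom_ext fun i => ?_
      -- Generators are indexed from `0`, so `X i` corresponds to `e_{i+1}`, with `i + 1 ≤ d`.
      have hX : esymmAlgHom (Fin d) ℂ d (X i) = E (i + 1) := Subtype.ext (by
        rw [esymmAlgHom_apply, aeval_X])
      change ψ (esymmAlgHom (Fin d) ℂ d (X i)) = aeval z (esymmAlgHom (Fin d) ℂ d (X i)).1
      rw [hX, hψE _ i.2]
      rfl
    exact DFunLike.congr_fun this q
  refine ⟨⟨z, hnorm⟩, fun f => eq_of_forall_dist_le fun ε hε => ?_⟩
  -- `φ` and evaluation at `z` agree on `p` and are both contractive, so each contributes at most `ε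
  -- / 2`.
  obtain ⟨p, hp⟩ := exists_symMap_close f (half_pos hε)
  have h1 := (norm_algHom_apply_le φ (f - symMap d p)).trans hp
  have h2 := ((f - symMap d p).1.norm_coe_le_norm ⟨z, hnorm⟩).trans hp
  have h3 : (f - symMap d p).1 ⟨z, hnorm⟩ = f.1 ⟨z, hnorm⟩ - ψ p := by
    rw [hψ, ← symMap_apply p ⟨z, hnorm⟩]
    rfl
  rw [h3] at h2
  rw [map_sub] at h1
  rw [dist_eq_norm]
  have h4 := norm_sub_le (φ f - ψ p) (f.1 ⟨z, hnorm⟩ - ψ p)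
  rw [sub_sub_sub_cancel_right] at h4
  change ‖φ f - ψ p‖ ≤ _ at h1
  linarith

/-! ### The homeomorphism with the orbit space -/

/-- The evaluation at a point of the closed polydisc, as a character. -/
noncomputable def evalChar (z : ClosedPolydisc d) :
    WeakDual.characterSpace ℂ (symPolydiscAlgebra d) :=
  ⟨StrongDual.toWeakDual (evalSub (symPolydiscAlgebra d) z).toContinuousLinearMap, by
    refine ⟨fun h => ?_, fun f g => map_mul (evalSub (symPolydiscAlgebra d) z) f g⟩
    have := DFunLike.congr_fun h (1 : symPolydiscAlgebra d)
    exact one_ne_zero ((map_one (evalSub (symPolydiscAlgebra d) z)).symm.trans this)⟩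

theorem continuous_evalChar : Continuous (evalChar (d := d)) :=
  Continuous.subtype_mk (WeakDual.continuous_of_continuous_eval fun f => f.1.continuous) _

/-- The evaluation map on the orbit space. -/
noncomputable def orbitEval (d : ℕ) :
    OrbitSpace d → WeakDual.characterSpace ℂ (symPolydiscAlgebra d) :=
  Quotient.lift evalChar (by
    rintro z _ ⟨σ, rfl⟩
    exact WeakDual.CharacterSpace.ext fun f => (apply_permute f σ z).symm)

theorem bijective_orbitEval (d : ℕ) : Function.Bijective (orbitEval d) := by
  constructor
  · rintro ⟨z⟩ ⟨w⟩ h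
    refine Quotient.sound ?_
    obtain ⟨σ, hσ⟩ := exists_perm_of_eval_esymm_eq (z := z.1) (w := w.1) fun j => by
      have := DFunLike.congr_fun h (symMap d ⟨esymm (Fin d) ℂ j, esymm_isSymmetric _ _ _⟩)
      exact ((symMap_apply _ z).symm.trans this).trans (symMap_apply _ w)
    exact ⟨σ, Subtype.ext (funext hσ)⟩
  · intro φ
    obtain ⟨z, hz⟩ := exists_forall_eq_apply (WeakDual.CharacterSpace.toAlgHom φ)
    exact ⟨Quotient.mk _ z, WeakDual.CharacterSpace.ext fun f => (hz f).symm⟩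

end SymPolydisc

open SymPolydisc in
theorem theorem3p4 (d : ℕ) :
    (∀ φ : SymPolydisc.symPolydiscAlgebra d →ₙₐ[ℂ] ℂ, φ ≠ 0 → Continuous φ) ∧
    ∃ ι : SymPolydisc.OrbitSpace d ≃ₜ
        WeakDual.characterSpace ℂ (SymPolydisc.symPolydiscAlgebra d),
      ∀ (z : SymPolydisc.ClosedPolydisc d) (f : SymPolydisc.symPolydiscAlgebra d),
        ι (Quotient.mk (SymPolydisc.orbitSetoid d) z) f = f.1 z := by
  refine ⟨fun φ hφ => ?_, ?_⟩
  · have hc : Continuous (unitalOfNeZero φ hφ) :=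
      AddMonoidHomClass.continuous_of_bound _ 1 fun f =>
        (norm_algHom_apply_le _ f).trans_eq (one_mul _).symm
    exact hc
  · have hc : Continuous (orbitEval d) := continuous_evalChar.quotient_lift _
    exact ⟨Continuous.homeoOfEquivCompactToT2
      (f := Equiv.ofBijective _ (bijective_orbitEval d)) hc, fun z f => rfl⟩
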